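/- For integers $a_1,\ldots,a_n\ge 0$ and a real number $p$ with $1\le p<\infty$, let $\mathbb{E}^{a_1}\oplus_p\cdots\oplus_p\mathbb{E}^{a_n}$ denote the product $\mathbb{R}^{a_1}\times\cdots\times\mathbb{R}^{a_n}$ equipped with the norm $\|(x_1,\ldots,x_n)\|_p=\bigl(\sum_{i=1}^n\|x_i\|^p\bigr)^{1/p}$, where $\|x_i\|$ is the Euclidean norm of $x_i\in\mathbb{R}^{a_i}$. A subset $S$ of this space is called equilateral if $\|x-y\|_p$ has the same value for all pairs of distinct points $x,y\in S$. Theorem. For every real $p\ge 1$ and every integer $a\ge 0$ with $2p>a$ there is a constant $c_{p,a}>0$, depending only on $p$ and $a$, such that for every $n\ge 1$ and all $a_1,\ldots,a_n$ with $\max_{1\le i\le n}a_i=a$, every equilateral set in $\mathbb{E}^{a_1}\oplus_p\cdots\oplus_p\mathbb{E}^{a_n}$ is finite and has at most $$c_{p,a}\,n^{\frac{2p+2a}{2p-a}}$$ points. -/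

import Mathlib

/-- A set of points is equilateral if the distances between its distinct points take
at most one value. (Sets with at most one point count as equilateral.) -/
def IsEquilateral {X : Type*} [Dist X] (S : Set X) : Prop :=
  ∃ r : ℝ, S.Pairwise fun x y => dist x y = r

/-- The `ℓ_p`-sum of the Euclidean spaces of dimensions `dims 0, …, dims (n - 1)`,
for a real exponent `p`. -/
abbrev EuclideanLpSum (p : ℝ) {n : ℕ} (dims : Fin n → ℕ) : Type :=
  PiLp (ENNReal.ofReal p) fun i => EuclideanSpace ℝ (Fin (dims i))

/-- The distance of the `ℓ_p`-sum, written out. -/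
theorem EuclideanLpSum.dist_eq {p : ℝ} (hp : 1 ≤ p) {n : ℕ} {dims : Fin n → ℕ}
    (x y : EuclideanLpSum p dims) :
    dist x y = (∑ i, ‖x i - y i‖ ^ p) ^ (1 / p) := by
  have h0 : 0 ≤ p := by linarith
  have h : (ENNReal.ofReal p).toReal = p := ENNReal.toReal_ofReal h0
  rw [PiLp.dist_eq_sum (by rw [h]; linarith), h]
  simp only [dist_eq_norm]

/-! Scale the common distance to 1. On `N` equilateral points the matrix `1 - ‖x - y‖ ^ p` is then
the identity. Replacing each summand `t ^ p` by an even polynomial `Q (t ^ 2)` with error `O(m ^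
(-p))` perturbs the entries by `O(n m ^ (-p))`, and the new matrix factors through dimension `1 + n
(2 m + 1) ^ a`. By `card_le_of_near_identity`, entry errors of order `N ^ (-1/2)` still force rank
at least `N / 13`. Taking `m` of order `(n √N) ^ (1 / p)` gives `N ≤ B n (n √N) ^ (a / p)`; the
power of `N` on the right is `a / (2 p) < 1`, so this can be solved for `N`.

The approximation truncates the Fourier series of `|cos x| ^ p`, whose coefficients obey a two-term
recurrence. -/

/-! ### Tail bounds from a two-term recurrence -/

/-- A real sequence with `(α + j + 1) c (j + 1) = (α - j) c j` is absolutely summable, and its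
tails decay like `m ^ (-2 α)`. -/
theorem exists_tsum_abs_tail_le_of_recurrence {α : ℝ} (hα : 0 < α) {c : ℕ → ℝ}
    (hc : ∀ j : ℕ, (α + j + 1) * c (j + 1) = (α - j) * c j) :
    Summable (fun j => |c j|) ∧
      ∃ K : ℝ, 0 < K ∧ ∀ m : ℕ, 0 < m → ∑' j, |c (j + m)| ≤ K * (m : ℝ) ^ (-(2 * α)) := by
  set J := ⌈α⌉₊ with hJ
  have hαJ : α ≤ J := Nat.le_ceil α
  have hrec : ∀ j, J ≤ j → (α + j + 1) * |c (j + 1)| = (j - α) * |c j| := by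
    intro j hj
    have hj' : (J : ℝ) ≤ j := by exact_mod_cast hj
    have h := congrArg abs (hc j)
    rw [abs_mul, abs_mul, abs_of_pos (by positivity : (0 : ℝ) < α + j + 1), abs_sub_comm,
      abs_of_nonneg (by linarith : (0 : ℝ) ≤ j - α)] at h
    exact h
  -- Bernoulli's inequality bounds the ratio `(j - α) / (j + α + 1)` by `((j + α) / (j + α + 1)) ^
  -- (2 α + 1)`.
  have hstep : ∀ j, J ≤ j → |c (j + 1)| * ((j + 1 : ℕ) + α) ^ (2 * α + 1) ≤
      |c j| * ((j : ℝ) + α) ^ (2 * α + 1) := by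
    intro j hj
    have hpos : (0 : ℝ) < α + j + 1 := by positivity
    have hpos' : (0 : ℝ) < (j + α) / (α + j + 1) := by positivity
    have hb := one_add_mul_self_le_rpow_one_add (s := -(1 / (α + j + 1))) (p := 2 * α + 1)
      (by rw [neg_le_neg_iff, div_le_one hpos]; linarith [(Nat.cast_nonneg j : (0 : ℝ) ≤ j)])
      (by linarith)
    have e1 : 1 + (2 * α + 1) * -(1 / (α + j + 1)) = (j - α) / (α + j + 1) := by
      field_simp; ring
    have e2 : 1 + -(1 / (α + j + 1)) = (j + α) / (α + j + 1) := by
      field_simp; ring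
    rw [e1, e2, Real.div_rpow (by positivity) hpos.le] at hb
    have e3 : |c (j + 1)| = (j - α) / (α + j + 1) * |c j| := by
      have := hrec j hj
      field_simp
      linarith
    have e4 : (((j + 1 : ℕ) : ℝ) + α) = α + j + 1 := by push_cast; ring
    have hq : 0 < (α + j + 1) ^ (2 * α + 1) := by positivity
    rw [e3, e4]
    rw [le_div_iff₀ hq] at hb
    nlinarith [mul_le_mul_of_nonneg_left hb (abs_nonneg (c j))]
  set w : ℕ → ℝ := fun j => |c j| * ((j : ℝ) + α) ^ (2 * α + 1) with hw
  have hw0 : ∀ j, 0 ≤ w j := fun j => by positivity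
  have hwle : ∀ k, w (J + k) ≤ w J := by
    intro k
    induction k with
    | zero => rfl
    | succ k ih => exact (hstep (J + k) (by omega)).trans ih
  -- The recurrence telescopes: `2 α |c j| = (j + α) |c j| - (j + 1 + α) |c (j + 1)|`.
  have htel : ∀ m, J ≤ m → ∀ N, ∑ j ∈ Finset.range N, |c (j + m)| =
      ((m + α) * |c m| - (((N + m : ℕ) : ℝ) + α) * |c (N + m)|) / (2 * α) := by
    intro m hm N
    induction N with
    | zero => simp
    | succ N ih =>
      rw [Finset.sum_range_succ, ih]
      have h1 := hrec (N + m) (by omega)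
      have e : N + 1 + m = N + m + 1 := by ring
      rw [e]
      field_simp
      push_cast at h1 ⊢
      linarith
  have hpart : ∀ m, J ≤ m → ∀ N, ∑ j ∈ Finset.range N, |c (j + m)| ≤
      (m + α) * |c m| / (2 * α) := by
    intro m hm N
    rw [htel m hm N]
    gcongr
    have : 0 ≤ (((N + m : ℕ) : ℝ) + α) * |c (N + m)| := by positivity
    linarith
  have hsum : Summable (fun j => |c j|) :=
    (summable_nat_add_iff J).1
      (summable_of_sum_range_le (fun _ => abs_nonneg _) (hpart J le_rfl))
  -- The first term serves `m ≥ J`, the second `m ≤ J`; the `1` ensures positivity.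
  refine ⟨hsum, w J / (2 * α) + (∑' j, |c j|) * (J : ℝ) ^ (2 * α) + 1, ?_, ?_⟩
  · have : 0 ≤ ∑' j, |c j| := tsum_nonneg fun _ => abs_nonneg _
    have := hw0 J
    positivity
  · intro m hm
    have hm' : (0 : ℝ) < m := by exact_mod_cast hm
    have hT : 0 ≤ ∑' j, |c j| := tsum_nonneg fun _ => abs_nonneg _
    have hmp : 0 < (m : ℝ) ^ (-(2 * α)) := by positivity
    have hA : 0 ≤ w J / (2 * α) := div_nonneg (hw0 J) (by positivity)
    have hB : 0 ≤ (∑' j, |c j|) * (J : ℝ) ^ (2 * α) := by positivity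
    rcases le_total J m with h | h
    · have h1 : ∑' j, |c (j + m)| ≤ (m + α) * |c m| / (2 * α) :=
        Real.tsum_le_of_sum_range_le (fun _ => abs_nonneg _) (hpart m h)
      obtain ⟨k, rfl⟩ := Nat.exists_eq_add_of_le h
      have h2 : (((J + k : ℕ) : ℝ) + α) * |c (J + k)| =
          w (J + k) * (((J + k : ℕ) : ℝ) + α) ^ (-(2 * α)) := by
        have h3 : (0 : ℝ) < ((J + k : ℕ) : ℝ) + α := by positivity
        simp only [hw]
        rw [mul_assoc, ← Real.rpow_add h3, show 2 * α + 1 + -(2 * α) = 1 by ring, Real.rpow_one,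
          mul_comm]
      have h4 : (((J + k : ℕ) : ℝ) + α) ^ (-(2 * α)) ≤ ((J + k : ℕ) : ℝ) ^ (-(2 * α)) :=
        Real.rpow_le_rpow_of_nonpos hm' (by linarith) (by linarith)
      have h5 := mul_le_mul (hwle k) h4 (by positivity) (hw0 J)
      rw [h2] at h1
      calc _ ≤ _ := h1
        _ ≤ w J * ((J + k : ℕ) : ℝ) ^ (-(2 * α)) / (2 * α) := by gcongr
        _ = w J / (2 * α) * ((J + k : ℕ) : ℝ) ^ (-(2 * α)) := by ring
        _ ≤ _ := by
          apply mul_le_mul_of_nonneg_right _ hmp.le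
          linarith
    · have h1 : ∑' j, |c (j + m)| ≤ ∑' j, |c j| := by
        rw [← hsum.sum_add_tsum_nat_add m]
        have : 0 ≤ ∑ i ∈ Finset.range m, |c i| := Finset.sum_nonneg fun _ _ => abs_nonneg _
        linarith
      have h2 : 1 ≤ (J : ℝ) ^ (2 * α) * (m : ℝ) ^ (-(2 * α)) := by
        rw [Real.rpow_neg hm'.le, ← div_eq_mul_inv, one_le_div (by positivity)]
        exact Real.rpow_le_rpow hm'.le (by exact_mod_cast h) (by linarith)
      calc _ ≤ _ := h1
        _ = (∑' j, |c j|) * 1 := by ring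
        _ ≤ (∑' j, |c j|) * ((J : ℝ) ^ (2 * α) * (m : ℝ) ^ (-(2 * α))) := by gcongr
        _ = (∑' j, |c j|) * (J : ℝ) ^ (2 * α) * (m : ℝ) ^ (-(2 * α)) := by ring
        _ ≤ _ := by
          apply mul_le_mul_of_nonneg_right _ hmp.le
          linarith

/-! ### Fourier series of `|cos x| ^ p` and polynomial approximation -/

open Real intervalIntegral

/-- The cosine moments of `cos ^ p` over a half period. -/
noncomputable def cosPowMoment (p : ℝ) (j : ℕ) : ℝ :=
  ∫ x in (-(π / 2))..(π / 2), cos x ^ p * cos (2 * j * x)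

/-- Integrate the derivative of `cos x ^ (p + 1) * sin ((2 j + 1) x)`, which vanishes at both
endpoints. -/
theorem cosPowMoment_recurrence {p : ℝ} (hp : 0 < p) (j : ℕ) :
    (p / 2 + j + 1) * cosPowMoment p (j + 1) = (p / 2 - j) * cosPowMoment p j := by
  have hcont : ∀ k : ℕ, Continuous fun x : ℝ => cos x ^ p * cos (2 * k * x) := fun k =>
    (continuous_cos.rpow_const fun _ => Or.inr hp.le).mul (by fun_prop)
  have hder : ∀ x ∈ Set.Ioo (-(π / 2)) (π / 2),
      HasDerivAt (fun x : ℝ => cos x ^ (p + 1) * sin ((2 * j + 1) * x))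
      ((p / 2 + j + 1) * (cos x ^ p * cos (2 * (j + 1 : ℕ) * x)) -
        (p / 2 - j) * (cos x ^ p * cos (2 * j * x))) x := by
    intro x hx
    have hcx : 0 < cos x := cos_pos_of_mem_Ioo hx
    have h1 := (hasDerivAt_cos x).rpow_const (p := p + 1) (Or.inr (by linarith))
    have h2 : HasDerivAt (fun x : ℝ => sin ((2 * j + 1) * x))
        (cos ((2 * j + 1) * x) * (2 * j + 1)) x := by
      simpa using ((hasDerivAt_id x).const_mul (2 * (j : ℝ) + 1)).sin
    refine (h1.mul h2).congr_deriv ?_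
    rw [add_sub_cancel_right, rpow_add hcx, rpow_one]
    have e1 : 2 * ((j + 1 : ℕ) : ℝ) * x = (2 * j + 1) * x + x := by push_cast; ring
    have e2 : 2 * (j : ℝ) * x = (2 * j + 1) * x - x := by ring
    rw [e1, e2, cos_add, cos_sub]
    ring
  have hint : ∀ k : ℕ, IntervalIntegrable (fun x : ℝ => cos x ^ p * cos (2 * k * x))
      MeasureTheory.volume (-(π / 2)) (π / 2) := fun k => (hcont k).intervalIntegrable _ _
  have hFcont : Continuous fun x : ℝ => cos x ^ (p + 1) * sin ((2 * j + 1) * x) :=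
    (continuous_cos.rpow_const fun _ => Or.inr (by linarith)).mul (by fun_prop)
  have := integral_eq_sub_of_hasDerivAt_of_le (by linarith [pi_pos]) hFcont.continuousOn hder
    (((hint (j + 1)).const_mul _).sub ((hint j).const_mul _))
  rw [integral_sub ((hint (j + 1)).const_mul _) ((hint j).const_mul _), integral_const_mul,
    integral_const_mul] at this
  simp only [cos_pi_div_two, cos_neg, zero_rpow (by linarith : p + 1 ≠ 0), zero_mul, sub_zero]
    at this
  unfold cosPowMoment
  linarith

instance factPiPos : Fact (0 < π) := ⟨pi_pos⟩

/-- The function `|cos x| ^ p` on the circle of length `π`. -/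
noncomputable def absCosPow (p : ℝ) (hp : 0 < p) : C(AddCircle π, ℂ) where
  toFun := Function.Periodic.lift (f := fun x : ℝ => ((|cos x| ^ p : ℝ) : ℂ)) (c := π)
    (by intro x; simp)
  continuous_toFun := by
    refine continuous_coinduced_dom.mpr ?_
    exact Complex.continuous_ofReal.comp (continuous_cos.abs.rpow_const fun _ => Or.inr hp.le)

theorem absCosPow_coe (p : ℝ) (hp : 0 < p) (x : ℝ) :
    absCosPow p hp (x : AddCircle π) = ((|cos x| ^ p : ℝ) : ℂ) := rfl

theorem fourierCoeff_absCosPow (p : ℝ) (hp : 0 < p) (k : ℤ) :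
    fourierCoeff (absCosPow p hp) k = ((cosPowMoment p k.natAbs / π : ℝ) : ℂ) := by
  set F : ℝ → ℂ := fun x => fourier (-k) (x : AddCircle π) • absCosPow p hp x with hF
  have hFc : Continuous F := by
    have h1 : Continuous fun x : ℝ => (x : AddCircle π) := AddCircle.continuous_mk' π
    exact ((fourier (-k)).continuous.comp h1).smul ((absCosPow p hp).continuous.comp h1)
  have hFx : ∀ x, F x = Complex.exp (-(2 * k * x * Complex.I)) * ((|cos x| ^ p : ℝ) : ℂ) := by
    intro x
    simp only [hF, smul_eq_mul, absCosPow_coe, fourier_coe_apply]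
    congr 2
    have : (π : ℂ) ≠ 0 := by exact_mod_cast pi_ne_zero
    field_simp
    push_cast
    ring
  have hsymm : ∀ x, F x + F (-x) = ((2 * (|cos x| ^ p * cos (2 * k * x)) : ℝ) : ℂ) := by
    intro x
    rw [hFx, hFx, cos_neg, ← add_mul]
    have : Complex.exp (-(2 * k * x * Complex.I)) + Complex.exp (-(2 * k * (-x : ℝ) * Complex.I)) =
        2 * Complex.cos (2 * k * x) := by
      rw [Complex.two_cos, add_comm]
      congr 2 <;> push_cast <;> ring
    rw [this]
    push_cast
    ring
  have hneg : ∫ x in (-(π / 2))..(π / 2), F (-x) = ∫ x in (-(π / 2))..(π / 2), F x := by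
    rw [integral_comp_neg]; simp
  have hadd : (2 : ℂ) * ∫ x in (-(π / 2))..(π / 2), F x =
      ((2 * cosPowMoment p k.natAbs : ℝ) : ℂ) := by
    calc (2 : ℂ) * ∫ x in (-(π / 2))..(π / 2), F x
        = (∫ x in (-(π / 2))..(π / 2), F x) + ∫ x in (-(π / 2))..(π / 2), F (-x) := by
          rw [hneg]; ring
      _ = ∫ x in (-(π / 2))..(π / 2), (F x + F (-x)) :=
          (integral_add (hFc.intervalIntegrable _ _)
            ((hFc.comp continuous_neg).intervalIntegrable _ _)).symm
      _ = ∫ x in (-(π / 2))..(π / 2), ((2 * (|cos x| ^ p * cos (2 * k * x)) : ℝ) : ℂ) := by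
          simp_rw [hsymm]
      _ = ((∫ x in (-(π / 2))..(π / 2), 2 * (|cos x| ^ p * cos (2 * k * x)) : ℝ) : ℂ) :=
          integral_ofReal
      _ = _ := by
          rw [integral_const_mul, cosPowMoment]
          congr 2
          refine integral_congr fun x hx => ?_
          rw [Set.uIcc_of_le (by linarith [pi_pos])] at hx
          have h1 : |cos x| = cos x := abs_of_nonneg (cos_nonneg_of_mem_Icc hx)
          have h2 : cos (2 * (k.natAbs : ℝ) * x) = cos (2 * k * x) := by
            rw [Nat.cast_natAbs, Int.cast_abs]
            rcases abs_choice (k : ℝ) with h | h <;> rw [h]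
            rw [← cos_neg]; congr 1; ring
          simp only [h1, h2]
  have hI : ∫ x in (-(π / 2))..(π / 2), F x = ((cosPowMoment p k.natAbs : ℝ) : ℂ) := by
    have h2 : (2 : ℂ) ≠ 0 := two_ne_zero
    apply mul_left_cancel₀ h2
    rw [hadd]; push_cast; ring
  rw [fourierCoeff_eq_intervalIntegral _ k (-(π / 2)), show -(π / 2) + π = π / 2 by ring]
  change (1 / π) • (∫ x in (-(π / 2))..(π / 2), F x) = _
  rw [hI, Complex.real_smul, ← Complex.ofReal_mul]
  congr 1
  ring

/-- `t ^ p` is approximated on `[0, 1]` by even polynomials of degree `2 m` with error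
`O (m ^ (-p))`. -/
theorem exists_even_polynomial_approx_rpow {p : ℝ} (hp : 0 < p) :
    ∃ K : ℝ, 1 ≤ K ∧ ∀ m : ℕ, 0 < m → ∃ Q : Polynomial ℝ, Q.natDegree ≤ m ∧
      ∀ t ∈ Set.Icc (0 : ℝ) 1, |t ^ p - Q.eval (t ^ 2)| ≤ K * (m : ℝ) ^ (-p) := by
  set c := cosPowMoment p with hc
  obtain ⟨hsum, K, hK, htail⟩ := exists_tsum_abs_tail_le_of_recurrence (α := p / 2) (by positivity)
    (cosPowMoment_recurrence hp)
  rw [show 2 * (p / 2) = p by ring] at htail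
  have hcoeff : Summable (fourierCoeff (absCosPow p hp)) := by
    have h1 : Summable fun j => |c j| / π := hsum.div_const π
    refine Summable.of_norm ?_
    have h2 : ∀ k : ℤ, ‖fourierCoeff (absCosPow p hp) k‖ = |c k.natAbs| / π := by
      intro k
      rw [fourierCoeff_absCosPow, Complex.norm_real, norm_eq_abs, abs_div, abs_of_pos pi_pos]
    simp_rw [h2]
    refine Summable.of_nat_of_neg ?_ ?_ <;> simpa using h1
  -- Pairing `k` with `-k` counts the term `k = 0` twice, hence the extra `c 0 / π`.
  have hseries : ∀ x : ℝ, HasSum (fun j : ℕ => 2 / π * (c j * cos (2 * j * x)))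
      (|cos x| ^ p + c 0 / π) := by
    intro x
    have h1 := has_pointwise_sum_fourier_series_of_summable hcoeff (x : AddCircle π)
    rw [absCosPow_coe] at h1
    have h2 := (Complex.hasSum_re h1).nat_add_neg
    have h3 : ∀ k : ℤ, (fourierCoeff (absCosPow p hp) k • fourier k (x : AddCircle π)).re =
        c k.natAbs / π * cos (2 * k * x) := by
      intro k
      rw [fourierCoeff_absCosPow, smul_eq_mul, Complex.re_ofReal_mul, fourier_coe_apply]
      congr 1
      have h4 : (2 * π * Complex.I * k * x / π : ℂ) = ((2 * k * x : ℝ) : ℂ) * Complex.I := by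
        have : (π : ℂ) ≠ 0 := by exact_mod_cast pi_ne_zero
        field_simp
        push_cast
        ring
      rw [h4, Complex.exp_ofReal_mul_I_re]
    simp only [h3, Complex.ofReal_re] at h2
    convert h2 using 1
    · funext j
      have : cos (2 * ((-(j : ℤ) : ℤ) : ℝ) * x) = cos (2 * j * x) := by
        rw [← cos_neg]; congr 1; push_cast; ring
      rw [this]
      simp only [Int.natAbs_neg, Int.natAbs_natCast, Int.cast_natCast]
      ring
    · simp
  refine ⟨2 / π * K + 1, by have := pi_pos; linarith [show 0 < 2 / π * K by positivity],
    fun m hm => ?_⟩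
  -- With `t = cos x`, `cos (2 j x)` is `T_j (2 t ^ 2 - 1)`, a polynomial in `t ^ 2` of degree `j`.
  refine ⟨-Polynomial.C (c 0 / π) + ∑ j ∈ Finset.range m,
    Polynomial.C (2 / π * c j) * (Polynomial.Chebyshev.T ℝ j).comp
      (Polynomial.C 2 * Polynomial.X - 1), ?_, ?_⟩
  · refine (Polynomial.natDegree_add_le _ _).trans (max_le (by simp) ?_)
    refine Polynomial.natDegree_sum_le_of_forall_le _ _ fun j hj => ?_
    refine (Polynomial.natDegree_C_mul_le _ _).trans (Polynomial.natDegree_comp_le.trans ?_)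
    rw [Polynomial.Chebyshev.natDegree_T]
    have h1 : (Polynomial.C 2 * Polynomial.X - 1 : Polynomial ℝ).natDegree ≤ 1 := by
      compute_degree
    have := Finset.mem_range.1 hj
    simp only [Int.natAbs_natCast]
    nlinarith
  · intro t ht
    set x := arccos t with hx
    have hcos : cos x = t := cos_arccos (by linarith [ht.1]) ht.2
    have h1 := (hseries x)
    rw [hcos, abs_of_nonneg ht.1] at h1
    have h2 := h1.summable.sum_add_tsum_nat_add m
    rw [h1.tsum_eq] at h2
    have h3 : ∀ j : ℕ, (Polynomial.Chebyshev.T ℝ j).eval (2 * t ^ 2 - 1) = cos (2 * j * x) := by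
      intro j
      rw [← hcos, ← cos_two_mul, Polynomial.Chebyshev.T_real_cos]
      congr 1
      push_cast
      ring
    have h4 : t ^ p - (-Polynomial.C (c 0 / π) + ∑ j ∈ Finset.range m,
        Polynomial.C (2 / π * c j) * (Polynomial.Chebyshev.T ℝ j).comp
        (Polynomial.C 2 * Polynomial.X - 1)).eval (t ^ 2) =
        ∑' j : ℕ, 2 / π * (c (j + m) * cos (2 * (j + m : ℕ) * x)) := by
      simp only [Polynomial.eval_add, Polynomial.eval_neg, Polynomial.eval_C,
        Polynomial.eval_finsetSum, Polynomial.eval_mul, Polynomial.eval_comp, Polynomial.eval_sub,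
        Polynomial.eval_X, Polynomial.eval_one, h3, mul_assoc] at h2 ⊢
      linarith
    have hmp : 0 ≤ (m : ℝ) ^ (-p) := by positivity
    have hle : ∀ j : ℕ, ‖c (j + m) * cos (2 * (j + m : ℕ) * x)‖ ≤ |c (j + m)| := by
      intro j
      rw [norm_mul, norm_eq_abs, norm_eq_abs]
      exact mul_le_of_le_one_right (abs_nonneg _) (abs_cos_le_one _)
    rw [h4, tsum_mul_left, abs_mul, abs_of_pos (div_pos two_pos pi_pos)]
    have h5 : |∑' j : ℕ, c (j + m) * cos (2 * (j + m : ℕ) * x)| ≤ ∑' j, |c (j + m)| :=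
      tsum_of_norm_bounded ((summable_nat_add_iff m).2 hsum).hasSum hle
    calc _ ≤ 2 / π * (K * (m : ℝ) ^ (-p)) := by
          gcongr
          exact h5.trans (htail m hm)
      _ ≤ _ := by linarith

/-! ### Rank of near-identity matrices -/

theorem Matrix.IsHermitian.sum_sq_eq_sum_eigenvalues_sq {ι : Type*} [Fintype ι] [DecidableEq ι]
    {A : Matrix ι ι ℝ} (hA : A.IsHermitian) :
    ∑ i, ∑ j, A i j ^ 2 = ∑ i, hA.eigenvalues i ^ 2 := by
  have h1 : ∑ i, ∑ j, A i j ^ 2 = (A * A).trace := by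
    simp only [Matrix.trace, Matrix.diag, Matrix.mul_apply]
    refine Finset.sum_congr rfl fun i _ => Finset.sum_congr rfl fun j _ => ?_
    have := hA.apply i j
    simp only [star_trivial] at this
    rw [this, sq]
  rw [h1]
  conv_lhs => rw [hA.spectral_theorem]
  rw [← map_mul, Unitary.conjStarAlgAut_apply, Matrix.trace_mul_cycle]
  simp [Matrix.diagonal_mul_diagonal, Matrix.trace_diagonal, sq]

/-- Cauchy–Schwarz over the nonzero eigenvalues, of which there are `A.rank`. -/
theorem Matrix.IsHermitian.trace_sq_le_rank_mul_sum_sq {ι : Type*} [Fintype ι]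
    {A : Matrix ι ι ℝ} (hA : A.IsHermitian) :
    A.trace ^ 2 ≤ A.rank * ∑ i, ∑ j, A i j ^ 2 := by
  classical
  rw [hA.sum_sq_eq_sum_eigenvalues_sq, hA.trace_eq_sum_eigenvalues,
    hA.rank_eq_card_non_zero_eigs, Fintype.card_subtype]
  simp only [RCLike.ofReal_real_eq_id, id]
  rw [← Finset.sum_filter_ne_zero]
  refine (sq_sum_le_card_mul_sum_sq).trans ?_
  gcongr
  exact Finset.filter_subset _ _

/-- A real symmetric matrix of inner rank at most `card κ` that is close to the identity has
at most `13 * card κ` rows. -/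
theorem card_le_of_near_identity {ι κ : Type*} [Fintype ι] [Fintype κ] (A : Matrix ι ι ℝ)
    (hA : A.IsHermitian) (U : Matrix ι κ ℝ) (V : Matrix κ ι ℝ) (hUV : A = U * V) {ε : ℝ}
    (hε : ε ≤ 1 / 2) (hεN : (Fintype.card ι : ℝ) * ε ^ 2 ≤ 1)
    (hdiag : ∀ i, |A i i - 1| ≤ ε) (hoff : ∀ i j, i ≠ j → |A i j| ≤ ε) :
    (Fintype.card ι : ℝ) ≤ 13 * Fintype.card κ := by
  classical
  set N : ℝ := (Fintype.card ι : ℝ) with hN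
  have hN0 : 0 ≤ N := by positivity
  have hrank : (A.rank : ℝ) ≤ Fintype.card κ := by
    rw [hUV]
    exact_mod_cast (Matrix.rank_mul_le_left U V).trans (Matrix.rank_le_card_width U)
  have htr : N / 2 ≤ A.trace := by
    have : ∑ _i : ι, (1 / 2 : ℝ) ≤ ∑ i, A i i :=
      Finset.sum_le_sum fun i _ => by linarith [(abs_le.1 (hdiag i)).1]
    rw [Finset.sum_const, Finset.card_univ, nsmul_eq_mul] at this
    simp only [Matrix.trace, Matrix.diag]
    linarith
  -- The diagonal entry is at most `3 / 2`, and `N ε ^ 2 ≤ 1`: `9 / 4 + 1 = 13 / 4`.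
  have hrow : ∀ i, ∑ j, A i j ^ 2 ≤ 13 / 4 := by
    intro i
    have h1 : ∀ j, A i j ^ 2 ≤ ε ^ 2 + if i = j then 9 / 4 else 0 := by
      intro j
      split_ifs with h
      · subst h
        have := abs_le.1 (hdiag i)
        nlinarith [sq_nonneg ε]
      · have := sq_le_sq' (abs_le.1 (hoff i j h)).1 (abs_le.1 (hoff i j h)).2
        linarith
    refine (Finset.sum_le_sum fun j _ => h1 j).trans ?_
    rw [Finset.sum_add_distrib, Finset.sum_const, Finset.card_univ, nsmul_eq_mul,
      Finset.sum_ite_eq]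
    simp only [Finset.mem_univ, if_true]
    linarith
  have hfrob : ∑ i, ∑ j, A i j ^ 2 ≤ N * (13 / 4) := by
    refine (Finset.sum_le_sum fun i _ => hrow i).trans_eq ?_
    rw [Finset.sum_const, Finset.card_univ, nsmul_eq_mul]
  have h := hA.trace_sq_le_rank_mul_sum_sq
  have h3 : (A.rank : ℝ) * ∑ i, ∑ j, A i j ^ 2 ≤ Fintype.card κ * (N * (13 / 4)) :=
    mul_le_mul hrank hfrob (Finset.sum_nonneg fun _ _ => Finset.sum_nonneg fun _ _ => sq_nonneg _)
      (by positivity)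
  have h4 : (N / 2) ^ 2 ≤ A.trace ^ 2 := pow_le_pow_left₀ (by positivity) htr 2
  rcases hN0.eq_or_lt with h0 | h0
  · rw [← h0]; positivity
  · have : N * N ≤ N * (13 * Fintype.card κ) := by nlinarith
    exact le_of_mul_le_mul_left this h0

/-! ### Separation of polynomial kernels -/

open MvPolynomial in
/-- Polynomial kernels `Q (‖u - v‖ ^ 2)` separate into `(2 m + 1) ^ d` products. -/
theorem exists_polynomial_norm_sub_sq_separation (Q : Polynomial ℝ) {m : ℕ}
    (hQ : Q.natDegree ≤ m) (d : ℕ) :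
    ∃ f g : EuclideanSpace ℝ (Fin d) → (Fin d → Fin (2 * m + 1)) → ℝ,
      ∀ u v, Q.eval (‖u - v‖ ^ 2) = ∑ e, f u e * g v e := by
  classical
  -- Expand in `u`: `f` collects monomials with all exponents at most `2 m`, `g` their coefficients,
  -- which depend on `v`.
  let D : EuclideanSpace ℝ (Fin d) → MvPolynomial (Fin d) ℝ := fun v =>
    ∑ k, (X k - C (v k)) ^ 2
  have hD : ∀ v, (D v).totalDegree ≤ 2 := by
    intro v
    refine totalDegree_finsetSum_le fun k _ => (totalDegree_pow _ _).trans ?_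
    have : (X k - C (v k) : MvPolynomial (Fin d) ℝ).totalDegree ≤ 1 := by
      refine (totalDegree_sub _ _).trans ?_
      simp
    omega
  let P : EuclideanSpace ℝ (Fin d) → MvPolynomial (Fin d) ℝ := fun v => Polynomial.aeval (D v) Q
  have hP : ∀ v, (P v).totalDegree ≤ 2 * m := by
    intro v
    simp only [P]
    rw [Polynomial.aeval_eq_sum_range]
    refine totalDegree_finsetSum_le fun k hk => (totalDegree_smul_le _ _).trans
      ((totalDegree_pow _ _).trans ?_)
    have := Finset.mem_range.1 hk
    nlinarith [hD v]
  let T : (Fin d → Fin (2 * m + 1)) → (Fin d →₀ ℕ) := fun e =>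
    Finsupp.equivFunOnFinite.symm fun k => (e k : ℕ)
  have hT : Function.Injective T := by
    intro e e' h
    have := Finsupp.equivFunOnFinite.symm.injective h
    funext k
    exact Fin.ext (congrFun this k)
  refine ⟨fun u e => ∏ k, u k ^ (e k : ℕ), fun v e => (P v).coeff (T e), fun u v => ?_⟩
  have h1 : eval (fun k => u k) (P v) = Q.eval (‖u - v‖ ^ 2) := by
    simp only [P]
    rw [← MvPolynomial.coe_aeval_eq_eval]
    simp only [RingHom.coe_coe]
    rw [← Polynomial.aeval_algHom_apply, Polynomial.coe_aeval_eq_eval]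
    congr 1
    simp [D, EuclideanSpace.norm_sq_eq]
  rw [← h1, eval_eq']
  have h2 : (P v).support ⊆ Finset.univ.image T := by
    intro s hs
    have h3 : ∀ k, s k < 2 * m + 1 := fun k =>
      Nat.lt_succ_of_le ((degreeOf_le_iff.1 ((degreeOf_le_totalDegree (P v) k).trans (hP v))) s hs)
    refine Finset.mem_image.2 ⟨fun k => ⟨s k, h3 k⟩, Finset.mem_univ _, ?_⟩
    ext k
    simp [T]
  rw [Finset.sum_subset h2 (fun s _ hs => by rw [notMem_support_iff.1 hs, zero_mul]),
    Finset.sum_image fun _ _ _ _ h => hT h]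
  refine Finset.sum_congr rfl fun e _ => ?_
  rw [mul_comm]
  simp [T]

/-! ### The cardinality bound -/

theorem card_le_of_equilateral_of_approx {p : ℝ} (hp : 1 ≤ p) {a n m : ℕ} {dims : Fin n → ℕ}
    (hdims : ∀ i, dims i ≤ a) (s : Finset (EuclideanLpSum p dims)) {r : ℝ} (hr : 0 < r)
    (hs : (s : Set (EuclideanLpSum p dims)).Pairwise fun x y => dist x y = r)
    (Q : Polynomial ℝ) (hQ : Q.natDegree ≤ m) {δ : ℝ}
    (hδ : ∀ t ∈ Set.Icc (0 : ℝ) 1, |t ^ p - Q.eval (t ^ 2)| ≤ δ)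
    (h1 : n * δ ≤ 1 / 2) (h2 : (s.card : ℝ) * (n * δ) ^ 2 ≤ 1) :
    (s.card : ℝ) ≤ 13 * (1 + n * (2 * m + 1) ^ a) := by
  choose f g hfg using fun i => exists_polynomial_norm_sub_sq_separation Q hQ (dims i)
  -- The index `none` carries the constant `1`.
  let κ := Option (Σ i, (Fin (dims i) → Fin (2 * m + 1)))
  let A : Matrix s s ℝ := Matrix.of fun x y => 1 - ∑ i, Q.eval (‖r⁻¹ • x.1 i - r⁻¹ • y.1 i‖ ^ 2)
  let U : Matrix s κ ℝ := Matrix.of fun x k => k.elim 1 fun e => -f e.1 (r⁻¹ • x.1 e.1) e.2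
  let V : Matrix κ s ℝ := Matrix.of fun k y => k.elim 1 fun e => g e.1 (r⁻¹ • y.1 e.1) e.2
  have hA : A.IsHermitian := by
    ext x y
    simp only [A, Matrix.conjTranspose_apply, Matrix.of_apply, star_trivial]
    refine congrArg _ (Finset.sum_congr rfl fun i _ => ?_)
    rw [norm_sub_rev]
  have hUV : A = U * V := by
    ext x y
    simp only [A, U, V, κ, Matrix.mul_apply, Matrix.of_apply, Fintype.sum_option, Fintype.sum_sigma, hfg,
      Option.elim, neg_mul, Finset.sum_neg_distrib]
    ring
  have hdist : ∀ x y : s, x ≠ y → ∑ i, ‖r⁻¹ • x.1 i - r⁻¹ • y.1 i‖ ^ p = 1 := by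
    intro x y hxy
    have h : dist x.1 y.1 = r := hs x.2 y.2 (fun h => hxy (Subtype.ext h))
    rw [EuclideanLpSum.dist_eq hp] at h
    have h0 : 0 ≤ ∑ i, ‖x.1 i - y.1 i‖ ^ p := Finset.sum_nonneg fun i _ => by positivity
    have h3 : ∑ i, ‖x.1 i - y.1 i‖ ^ p = r ^ p := by
      rw [← h, ← Real.rpow_mul h0, one_div, inv_mul_cancel₀ (by linarith), Real.rpow_one]
    have h4 : ∀ i, ‖r⁻¹ • x.1 i - r⁻¹ • y.1 i‖ ^ p = ‖x.1 i - y.1 i‖ ^ p / r ^ p := by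
      intro i
      rw [← smul_sub, norm_smul, Real.norm_of_nonneg (by positivity), inv_mul_eq_div,
        Real.div_rpow (norm_nonneg _) hr.le]
    simp_rw [h4]
    rw [← Finset.sum_div, h3, div_self (by positivity)]
  have hsum : ∀ t : Fin n → ℝ, (∀ i, t i ∈ Set.Icc (0 : ℝ) 1) →
      |∑ i, t i ^ p - ∑ i, Q.eval (t i ^ 2)| ≤ n * δ := by
    intro t ht
    rw [← Finset.sum_sub_distrib]
    refine (Finset.abs_sum_le_sum_abs _ _).trans ((Finset.sum_le_sum fun i _ => hδ _ (ht i)).trans ?_)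
    simp
  have hcard := card_le_of_near_identity A hA U V hUV h1 (by simpa using h2) ?_ ?_
  · have hκ : (Fintype.card κ : ℝ) ≤ 1 + n * (2 * m + 1) ^ a := by
      have : Fintype.card κ ≤ 1 + n * (2 * m + 1) ^ a := by
        simp only [κ, Fintype.card_option, Fintype.card_sigma, Fintype.card_fun, Fintype.card_fin]
        rw [add_comm]
        gcongr
        refine (Finset.sum_le_sum fun i _ => Nat.pow_le_pow_right (by omega) (hdims i)).trans ?_
        simp
      exact_mod_cast this
    rw [Fintype.card_coe] at hcard
    linarith
  · intro x
    have h := hsum (fun _ => 0) (fun _ => by simp)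
    simp only [A, Matrix.of_apply, sub_self, norm_zero]
    simp only [Real.zero_rpow (by linarith : p ≠ 0), Finset.sum_const_zero, zero_sub] at h
    rwa [sub_sub_cancel_left]
  · intro x y hxy
    -- Each coordinate distance is at most 1 because the `p`-th powers sum to 1.
    have h := hsum (fun i => ‖r⁻¹ • x.1 i - r⁻¹ • y.1 i‖) fun i => ⟨norm_nonneg _, by
      by_contra! hlt
      have h3 := Real.one_lt_rpow hlt (by linarith : 0 < p)
      have h4 := Finset.single_le_sum (f := fun i => ‖r⁻¹ • x.1 i - r⁻¹ • y.1 i‖ ^ p)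
        (fun i _ => by positivity) (Finset.mem_univ i)
      rw [hdist x y hxy] at h4
      exact absurd h4 (not_le.2 h3)⟩
    rwa [hdist x y hxy] at h

/-- Solving `N ≤ B n (n √N) ^ (a / p)` for `N`. -/
theorem le_of_le_mul_rpow_sqrt {p a B n N : ℝ} (hp : 0 < p) (ha : a < 2 * p) (hB : 0 < B)
    (hn : 0 < n) (hN : 0 < N) (h : N ≤ B * n * (n * √N) ^ (a / p)) :
    N ≤ B ^ (2 * p / (2 * p - a)) * n ^ ((2 * p + 2 * a) / (2 * p - a)) := by
  have hd : 0 < 2 * p - a := by linarith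
  have h1 : N ^ ((2 * p - a) / (2 * p)) ≤ B * n ^ ((p + a) / p) := by
    rw [Real.mul_rpow hn.le (Real.sqrt_nonneg _), Real.sqrt_eq_rpow, ← Real.rpow_mul hN.le] at h
    have e1 : (2 * p - a) / (2 * p) = 1 - 1 / 2 * (a / p) := by field_simp
    have e2 : (p + a) / p = 1 + a / p := by field_simp
    rw [e1, e2, Real.rpow_sub hN, Real.rpow_add hn, Real.rpow_one, Real.rpow_one,
      div_le_iff₀ (by positivity)]
    linarith
  have h2 := Real.rpow_le_rpow (by positivity) h1 (by positivity : 0 ≤ 2 * p / (2 * p - a))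
  rw [← Real.rpow_mul hN.le, Real.mul_rpow hB.le (by positivity), ← Real.rpow_mul hn.le] at h2
  have e1 : (2 * p - a) / (2 * p) * (2 * p / (2 * p - a)) = 1 := by field_simp
  have e2 : (p + a) / p * (2 * p / (2 * p - a)) = (2 * p + 2 * a) / (2 * p - a) := by
    field_simp
  rwa [e1, e2, Real.rpow_one] at h2

theorem exists_card_le_of_equilateral_finset {p : ℝ} (hp : 1 ≤ p) {a : ℕ}
    (ha : (a : ℝ) < 2 * p) :
    ∃ c : ℝ, 1 ≤ c ∧ ∀ (n : ℕ) (dims : Fin n → ℕ), 0 < n → (∀ i, dims i ≤ a) →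
      ∀ s : Finset (EuclideanLpSum p dims), IsEquilateral (s : Set (EuclideanLpSum p dims)) →
        (s.card : ℝ) ≤ c * (n : ℝ) ^ ((2 * p + 2 * (a : ℝ)) / (2 * p - (a : ℝ))) := by
  have hp0 : 0 < p := by linarith
  have hd : 0 < 2 * p - a := by linarith
  obtain ⟨K, hK, happrox⟩ := exists_even_polynomial_approx_rpow hp0
  -- `26` absorbs the `1 +` in `13 (1 + …)`, `6 ^ a` comes from `2 m + 1 ≤ 6 z ^ (1 / p)`, and `(2
  -- K) ^ (a / p)` from `z`.
  set B : ℝ := 26 * 6 ^ a * (2 * K) ^ (a / p) with hB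
  have hBpos : 0 < B := by positivity
  have hBp : 0 < B ^ (2 * p / (2 * p - a)) := by positivity
  refine ⟨B ^ (2 * p / (2 * p - a)) + 1, by linarith, ?_⟩
  rintro n dims hn hdims s ⟨r, hs⟩
  have hn1 : (1 : ℝ) ≤ n := by exact_mod_cast hn
  have hnpow : 1 ≤ (n : ℝ) ^ ((2 * p + 2 * (a : ℝ)) / (2 * p - (a : ℝ))) :=
    Real.one_le_rpow hn1 (by positivity)
  rcases le_or_gt s.card 1 with hcard | hcard
  · have : (s.card : ℝ) ≤ 1 := by exact_mod_cast hcard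
    nlinarith
  obtain ⟨x, hx, y, hy, hxy⟩ := Finset.one_lt_card.1 hcard
  have hr : 0 < r := by
    have : Fact (1 ≤ ENNReal.ofReal p) := ⟨by simpa using hp⟩
    rw [← hs hx hy hxy]
    exact dist_pos.2 hxy
  have hN1 : (1 : ℝ) ≤ s.card := by exact_mod_cast hcard.le
  set N : ℝ := (s.card : ℝ) with hN
  have hsq1 : 1 ≤ √N := Real.one_le_sqrt.2 hN1
  have hsq : √N ^ 2 = N := Real.sq_sqrt (by linarith)
  -- Chosen so that `m ^ p ≥ z` makes the total error at most `1 / (2 √N)`.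
  set z : ℝ := 2 * K * (n * √N) with hz
  have hz1 : 1 ≤ z := by
    have : 1 ≤ n * √N := one_le_mul_of_one_le_of_one_le hn1 hsq1
    nlinarith
  have hzp : 1 ≤ z ^ (1 / p) := Real.one_le_rpow hz1 (by positivity)
  set m := ⌈z ^ (1 / p)⌉₊ with hm
  have hmge : z ^ (1 / p) ≤ m := Nat.le_ceil _
  have hmlt : (m : ℝ) ≤ 2 * z ^ (1 / p) := by
    have := Nat.ceil_lt_add_one (a := z ^ (1 / p)) (by positivity)
    linarith
  have hm1 : (1 : ℝ) ≤ m := hzp.trans hmge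
  have hm0 : 0 < m := by exact_mod_cast (show (0 : ℝ) < m by linarith)
  obtain ⟨Q, hQ, hδ⟩ := happrox m hm0
  have hmp : (m : ℝ) ^ (-p) ≤ z⁻¹ := by
    rw [Real.rpow_neg (by positivity)]
    apply inv_anti₀ (by linarith)
    have := Real.rpow_le_rpow (by positivity) hmge hp0.le
    rwa [← Real.rpow_mul (by linarith), one_div, inv_mul_cancel₀ hp0.ne', Real.rpow_one] at this
  have hε : n * (K * (m : ℝ) ^ (-p)) ≤ 1 / (2 * √N) := by
    calc n * (K * (m : ℝ) ^ (-p)) ≤ n * (K * z⁻¹) := by gcongr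
      _ = 1 / (2 * √N) := by rw [hz]; field_simp
  have hε0 : 0 ≤ n * (K * (m : ℝ) ^ (-p)) := by positivity
  have hmain := card_le_of_equilateral_of_approx hp hdims s hr hs Q hQ hδ
    (hε.trans (by rw [div_le_div_iff₀ (by positivity) two_pos]; linarith))
    (by
      have h1 := pow_le_pow_left₀ hε0 hε 2
      calc N * _ ≤ N * (1 / (2 * √N)) ^ 2 := by gcongr
        _ = N / (4 * √N ^ 2) := by ring
        _ ≤ 1 := by rw [hsq, div_le_one (by positivity)]; linarith)
  have hbound : N ≤ B * n * (n * √N) ^ (a / p) := by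
    have h1 : (2 * (m : ℝ) + 1) ^ a ≤ 6 ^ a * z ^ (a / p) := by
      calc (2 * (m : ℝ) + 1) ^ a ≤ (6 * z ^ (1 / p)) ^ a := by gcongr; linarith
        _ = 6 ^ a * z ^ (a / p) := by
          rw [mul_pow, ← Real.rpow_mul_natCast (by linarith)]
          congr 2
          ring
    have h2 : (1 : ℝ) ≤ (2 * (m : ℝ) + 1) ^ a := one_le_pow₀ (by linarith)
    have h3 : z ^ (a / p) = (2 * K) ^ (a / p) * (n * √N) ^ (a / p) :=
      Real.mul_rpow (by positivity) (by positivity)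
    calc N ≤ 13 * (1 + n * (2 * m + 1) ^ a) := hmain
      _ ≤ 26 * (n * (2 * m + 1) ^ a) := by nlinarith
      _ ≤ 26 * (n * (6 ^ a * z ^ (a / p))) := by gcongr
      _ = B * n * (n * √N) ^ (a / p) := by rw [h3, hB]; ring
  refine (le_of_le_mul_rpow_sqrt hp0 ha hBpos (by linarith) (by linarith) hbound).trans ?_
  gcongr
  linarith

theorem theorem1p7 (p : ℝ) (hp : 1 ≤ p) (a : ℕ) (ha : (a : ℝ) < 2 * p) :
    ∃ c : ℝ, 0 < c ∧
      ∀ (n : ℕ) (dims : Fin n → ℕ), IsGreatest (Set.range dims) a →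
        ∀ S : Set (EuclideanLpSum p dims), IsEquilateral S →
          S.Finite ∧
            (S.ncard : ℝ) ≤ c * (n : ℝ) ^ ((2 * p + 2 * (a : ℝ)) / (2 * p - (a : ℝ))) := by
  obtain ⟨c, hc, hbound⟩ := exists_card_le_of_equilateral_finset hp ha
  refine ⟨c, by linarith, ?_⟩
  rintro n dims ⟨⟨i, _⟩, hmax⟩ S ⟨r, hS⟩
  have hb := hbound n dims i.pos fun j => hmax ⟨j, rfl⟩
  -- An infinite `S` would have finite subsets of every size, against the uniform bound.
  have hfin : S.Finite := by
    by_contra hinf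
    obtain ⟨N, hN⟩ := exists_nat_gt (c * (n : ℝ) ^ ((2 * p + 2 * (a : ℝ)) / (2 * p - (a : ℝ))))
    obtain ⟨s, hsS, hs⟩ := Set.Infinite.exists_subset_card_eq hinf N
    have := hb s ⟨r, hS.mono hsS⟩
    rw [hs] at this
    linarith
  refine ⟨hfin, ?_⟩
  rw [Set.ncard_eq_toFinset_card S hfin]
  exact hb _ ⟨r, by simpa using hS⟩
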